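/- Work in an arbitrary countably saturated nonstandard universe: there is a map $a\mapsto{}^*a$ from the standard objects over $\mathbb N$ (numbers, pairs, sets of such objects, and so on through all finite types) to internal objects which satisfies the transfer principle, and every countable family of internal sets with the finite intersection property has nonempty intersection. A set of internal objects is called \emph{countably determined} (CD) if it has the form $$X=\bigcup_{b\in B}\Bigl(\bigcap_{m\in b}X_m\cap\bigcap_{m\notin b}\bigl(\textstyle\bigcup_nX_n\setminus X_m\bigr)\Bigr)$$ for some sequence $(X_m)_{m\in\mathbb N}$ of internal sets and some $B\subseteq\mathcal P(\mathbb N)$; a map is CD if its graph is CD. For equivalence relations $\mathsf E$ on $X$ and $\mathsf F$ on $Y$, $\mathsf E$ is \emph{CD-reducible} to $\mathsf F$ if there is a CD map $\vartheta:X\to Y$ with $x\,\mathsf E\,x'\iff\vartheta(x)\,\mathsf F\,\vartheta(x')$ for all $x,x'\in X$. A \emph{cut} is an initial segment $U\subseteq{}^*\mathbb N$; it is \emph{additive} if $x+y\in U$ whenever $x,y\in U$, and \emph{countably cofinal} if $U=\bigcup_{n\in\mathbb N}[0,a_n)$ for some strictly increasing sequence $(a_n)_{n\in\mathbb N}$ in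 ${}^*\mathbb N$. For an additive countably cofinal cut $U$, let $x\,\mathsf E_U\,y$ iff $|x-y|\in U$, for $x,y\in{}^*\mathbb N$. For a hyperfinite (internal) set $D\subseteq{}^*\mathbb N$, let $\mathsf{FD}_D$ be the equivalence relation on the set of all internal subsets of $D$ given by $u\,\mathsf{FD}_D\,v$ iff the symmetric difference $u\,\triangle\,v$ is finite. \textbf{Theorem.} If $D\subseteq{}^*\mathbb N$ is an infinite hyperfinite set and $U$ is an additive countably cofinal cut in ${}^*\mathbb N$, then $\mathsf{FD}_D$ is not CD-reducible to $\mathsf E_U$. -/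

import Mathlib

universe u

namespace Nonstandard

/-! ## Typed superstructure over the natural numbers and its formulas -/

/-- The types of the objects of the superstructure over the natural numbers: natural numbers,
pairs, and sets of objects of a given type. -/
inductive Ty : Type
  | nat : Ty
  | prod : Ty → Ty → Ty
  | set : Ty → Ty

/-- The standard objects of each type. -/
def Ty.Std : Ty → Type
  | .nat => ℕ
  | .prod σ τ => Ty.Std σ × Ty.Std τ
  | .set τ => Set (Ty.Std τ)

/-- A structure for the language of membership and pairing over the types. -/
structure TypedStructure where
  /-- the objects of each type -/
  Obj : Ty → Type u
  /-- membership -/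
  mem : ∀ {τ : Ty}, Obj τ → Obj (.set τ) → Prop
  /-- pairing -/
  pair : ∀ {σ τ : Ty}, Obj σ → Obj τ → Obj (.prod σ τ)

/-- The full standard structure, with true membership and true pairs. -/
def standard : TypedStructure.{0} where
  Obj := Ty.Std
  mem := fun {τ} (x : Ty.Std τ) (A : Set (Ty.Std τ)) => x ∈ A
  pair := fun x y => (x, y)

/-- De Bruijn variables of type `τ` in a context listing the types of the free variables. -/
inductive Var : List Ty → Ty → Type
  | zero {Γ : List Ty} {τ : Ty} : Var (τ :: Γ) τ
  | succ {Γ : List Ty} {σ τ : Ty} : Var Γ τ → Var (σ :: Γ) τ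

/-- Terms: variables and pairs. -/
inductive Term (Γ : List Ty) : Ty → Type
  | var {τ : Ty} : Var Γ τ → Term Γ τ
  | pair {σ τ : Ty} : Term Γ σ → Term Γ τ → Term Γ (.prod σ τ)

/-- Formulas, with quantifiers over the objects of any given type. The remaining connectives and
the existential quantifier are definable from the listed ones. -/
inductive Formula : List Ty → Type
  | eq {Γ : List Ty} {τ : Ty} : Term Γ τ → Term Γ τ → Formula Γ
  | mem {Γ : List Ty} {τ : Ty} : Term Γ τ → Term Γ (.set τ) → Formula Γ
  | not {Γ : List Ty} : Formula Γ → Formula Γ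
  | and {Γ : List Ty} : Formula Γ → Formula Γ → Formula Γ
  | all {Γ : List Ty} (τ : Ty) : Formula (τ :: Γ) → Formula Γ

/-- An assignment of values to the variables of a context. -/
def Env (S : TypedStructure.{u}) (Γ : List Ty) : Type u :=
  ∀ τ : Ty, Var Γ τ → S.Obj τ

/-- Extend an assignment by a value for the new innermost variable. -/
def Env.cons {S : TypedStructure.{u}} {Γ : List Ty} {σ : Ty} (a : S.Obj σ) (ρ : Env S Γ) :
    Env S (σ :: Γ)
  | _, .zero => a
  | _, .succ v => ρ _ v

/-- The value of a term. -/
def Term.eval {S : TypedStructure.{u}} {Γ : List Ty} (ρ : Env S Γ) :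
    {τ : Ty} → Term Γ τ → S.Obj τ
  | _, .var v => ρ _ v
  | _, .pair s t => S.pair (s.eval ρ) (t.eval ρ)

/-- Truth of a formula in a structure under an assignment. -/
def Formula.Holds {S : TypedStructure.{u}} : {Γ : List Ty} → Formula Γ → Env S Γ → Prop
  | _, .eq s t, ρ => s.eval ρ = t.eval ρ
  | _, .mem s t, ρ => S.mem (s.eval ρ) (t.eval ρ)
  | _, .not φ, ρ => ¬ φ.Holds ρ
  | _, .and φ ψ, ρ => φ.Holds ρ ∧ ψ.Holds ρ
  | _, .all τ φ, ρ => ∀ a : S.Obj τ, φ.Holds (Env.cons a ρ)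

/-! ## Countably saturated nonstandard universes -/

/-- A countably saturated nonstandard universe: its objects (the internal objects), together with
a map `star` of the standard objects into it that satisfies the transfer principle, and such that
any countable family of internal sets with the finite intersection property has a common element.
(Saturation makes the extension of the natural numbers proper.) -/
structure Universe extends TypedStructure.{u} where
  /-- the nonstandard copy of a standard object -/
  star : ∀ {τ : Ty}, Ty.Std τ → Obj τ
  /-- the transfer principle -/
  transfer : ∀ {Γ : List Ty} (φ : Formula Γ) (ρ : Env standard Γ),
    φ.Holds ρ ↔ φ.Holds (S := toTypedStructure) (fun τ v => star (ρ τ v))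
  /-- countable saturation -/
  saturation : ∀ {τ : Ty} (A : ℕ → Obj (.set τ)),
    (∀ n : ℕ, ∃ x : Obj τ, ∀ m < n, mem x (A m)) → ∃ x : Obj τ, ∀ m : ℕ, mem x (A m)

namespace Universe

variable (M : Universe.{u})

/-- The hypernatural numbers. -/
abbrev HyperNat : Type u := M.Obj .nat

/-- The set of elements of an internal set. -/
def elems {τ : Ty} (A : M.Obj (.set τ)) : Set (M.Obj τ) := {x | M.mem x A}

/-- The order on the hypernatural numbers. -/
def Lt (x y : M.HyperNat) : Prop :=
  M.mem (M.pair x y) (M.star (τ := .set (.prod .nat .nat)) {p : ℕ × ℕ | p.1 < p.2})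

/-- `z = x + y` in the hypernatural numbers. -/
def IsSum (x y z : M.HyperNat) : Prop :=
  M.mem (M.pair (M.pair x y) z)
    (M.star (τ := .set (.prod (.prod .nat .nat) .nat)) {p : (ℕ × ℕ) × ℕ | p.2 = p.1.1 + p.1.2})

/-- `d = |x - y|` in the hypernatural numbers. -/
def IsAbsDiff (x y d : M.HyperNat) : Prop :=
  M.mem (M.pair (M.pair x y) d)
    (M.star (τ := .set (.prod (.prod .nat .nat) .nat))
      {p : (ℕ × ℕ) × ℕ | (p.2 : ℤ) = |(p.1.1 : ℤ) - (p.1.2 : ℤ)|})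

/-- An internal set of hypernatural numbers is hyperfinite if it belongs to the nonstandard copy
of the family of all finite sets of natural numbers. -/
def Hyperfinite (D : M.Obj (.set .nat)) : Prop :=
  M.mem D (M.star (τ := .set (.set .nat)) {A : Set ℕ | A.Finite})

/-- The (internal) power set: all internal subsets of `D`. -/
def internalSubsets {τ : Ty} (D : M.Obj (.set τ)) : Set (M.Obj (.set τ)) :=
  {v | M.elems v ⊆ M.elems D}

/-! ### Cuts -/

/-- A cut: an initial segment of the hypernatural numbers. -/
def IsCut (U : Set M.HyperNat) : Prop := ∀ x y : M.HyperNat, M.Lt x y → y ∈ U → x ∈ U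

/-- Closure under addition. -/
def IsAdditive (U : Set M.HyperNat) : Prop :=
  ∀ x ∈ U, ∀ y ∈ U, ∀ z : M.HyperNat, M.IsSum x y z → z ∈ U

/-- `U` is the union of the intervals `[0, a n)` for a strictly increasing sequence `a`. -/
def IsCountablyCofinal (U : Set M.HyperNat) : Prop :=
  ∃ a : ℕ → M.HyperNat, (∀ m n : ℕ, m < n → M.Lt (a m) (a n)) ∧ U = ⋃ n : ℕ, {x | M.Lt x (a n)}

/-! ### Countably determined sets and reductions -/

/-- Countably determined sets. -/
def IsCD {τ : Ty} (X : Set (M.Obj τ)) : Prop :=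
  ∃ (A : ℕ → M.Obj (.set τ)) (B : Set (Set ℕ)),
    X = ⋃ b ∈ B, ((⋂ m ∈ b, M.elems (A m)) ∩ ⋂ m ∈ bᶜ, ((⋃ n, M.elems (A n)) \ M.elems (A m)))

/-- The relation `E` on `X` is CD-reducible to the relation `F` on `Y`: there is a map from `X`
to `Y` with countably determined graph that is a reduction. -/
def CDReducible {σ τ : Ty} (X : Set (M.Obj σ)) (E : M.Obj σ → M.Obj σ → Prop)
    (Y : Set (M.Obj τ)) (F : M.Obj τ → M.Obj τ → Prop) : Prop :=
  ∃ θ : X → Y, M.IsCD {p : M.Obj (.prod σ τ) | ∃ x : X, p = M.pair (x : M.Obj σ) (θ x : M.Obj τ)} ∧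
    ∀ x x' : X, E x x' ↔ F (θ x) (θ x')

/-! ### The equivalence relations -/

/-- The finite difference relation on internal sets of hypernatural numbers: the symmetric
difference is (truly) finite. -/
def FD (v w : M.Obj (.set .nat)) : Prop := (symmDiff (M.elems v) (M.elems w)).Finite

/-- The monadic relation of `U`: `|x - y|` belongs to `U`. -/
def monadic (U : Set M.HyperNat) (x y : M.HyperNat) : Prop := ∃ d ∈ U, M.IsAbsDiff x y d

end Universe

end Nonstandard

/-!
Let `U` be the union of the intervals `[0, a n)`, and suppose that `θ` is a countably determined
reduction. By Ramsey's theorem and saturation, some internal family `F` of subsets of `D`, rich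
enough to contain all `k`-element subsets of a `p`-element set for all finite `k` and `p`, is not
split by any of the countably many internal sets that describe `θ`; hence on `F` the graph of `θ`
is the intersection of a decreasing sequence of internal relations `G n`. By saturation again, for
some `n` all points `(u, y)`, `(v, z)` of `G n` such that `u` and `v` differ by at most one exchange
satisfy `|y - z| < a n`, and then for some `K ≥ n` all points of `G K` with `|y - z| < a n` are such
that `u` and `v` differ at no more than `K` points. But let `k = K + 1` and take `2k + 2` disjoint
`k`-element sets in `F`: paths of exchanges keep their values within `k * a n` of the first one, so
two of these values are less than `a n` apart by the pigeonhole principle, although the two sets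
differ at `2k > K` points.
-/

namespace Nonstandard

/-! ## The finite Ramsey theorem and exchange paths -/

section FiniteSets

open Finset

variable {α : Type*}

/-- Some subset of `E` with at least `p` elements has all its `k`-element subsets in the colour
class `c`. -/
def HasMonochromaticSubset (k p : ℕ) (E : Finset α) (c : Set (Finset α)) : Prop :=
  ∃ E' ⊆ E, p ≤ #E' ∧ ∀ u ∈ E'.powersetCard k, u ∈ c

theorem HasMonochromaticSubset.mono {k p : ℕ} {E E' : Finset α} {c : Set (Finset α)}
    (h : HasMonochromaticSubset k p E c) (hE : E ⊆ E') : HasMonochromaticSubset k p E' c :=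
  let ⟨E₀, hE₀, hp⟩ := h
  ⟨E₀, hE₀.trans hE, hp⟩

variable (α) in
/-- `N` is an upper bound for the two-colour Ramsey number `R(p, q)` of `k`-element subsets. -/
def RamseyBound (k p q N : ℕ) : Prop :=
  ∀ E : Finset α, N ≤ #E → ∀ c : Set (Finset α),
    HasMonochromaticSubset k p E c ∨ HasMonochromaticSubset k q E cᶜ

theorem RamseyBound.symm {k p q N : ℕ} (h : RamseyBound α k p q N) : RamseyBound α k q p N :=
  fun E hE c => by simpa only [compl_compl] using (h E hE cᶜ).symm

theorem exists_pairwise_disjoint_powersetCard {k m : ℕ} {E : Finset α} (hE : m * k ≤ #E) :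
    ∃ W : Fin m → Finset α,
      (∀ i, W i ∈ E.powersetCard k) ∧ Pairwise (Function.onFun Disjoint W) := by
  obtain ⟨e⟩ : Nonempty (Fin m × Fin k ↪ E) :=
    Function.Embedding.nonempty_of_card_le (by simpa using hE)
  let g (i : Fin m) : Fin k ↪ α := ⟨fun j => e (i, j), fun j j' h => by simpa using h⟩
  refine ⟨fun i => univ.map (g i), fun i => mem_powersetCard.2 ⟨fun x hx => ?_, by simp⟩,
    fun i i' hii' => disjoint_left.2 fun x hx hx' => hii' ?_⟩
  · obtain ⟨j, -, rfl⟩ := mem_map.1 hx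
    exact (e (i, j)).2
  · obtain ⟨j, -, rfl⟩ := mem_map.1 hx
    obtain ⟨j', -, h⟩ := mem_map.1 hx'
    exact (congrArg Prod.fst (e.injective (Subtype.ext h))).symm

theorem exists_ne_abs_sub_lt {ι : Type*} [Fintype ι] {f : ι → ℤ} {c a : ℤ} {k : ℕ} (ha : 0 < a)
    (hf : ∀ i, |f i - c| ≤ k * a) (hι : 2 * k + 1 < Fintype.card ι) :
    ∃ i j, i ≠ j ∧ |f i - f j| < a := by
  have hbucket : ∀ i ∈ univ, (f i - c) / a ∈ Icc (-k : ℤ) k := fun i _ => by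
    obtain ⟨hlow, hhigh⟩ := abs_le.1 (hf i)
    exact mem_Icc.2 ⟨(Int.le_ediv_iff_mul_le ha).2 (by linarith),
      Int.ediv_le_of_le_mul ha hhigh⟩
  obtain ⟨i, -, j, -, hij, heq⟩ := exists_ne_map_eq_of_card_lt_of_maps_to
    (by rw [card_univ, Int.card_Icc]; omega) hbucket
  refine ⟨i, j, hij, ?_⟩
  have hi := Int.emod_add_mul_ediv (f i - c) a
  have hj := Int.emod_add_mul_ediv (f j - c) a
  rw [← heq] at hj
  have := abs_sub_lt_of_nonneg_of_lt (Int.emod_nonneg (f i - c) ha.ne')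
    (Int.emod_lt_of_pos (f i - c) ha) (Int.emod_nonneg (f j - c) ha.ne')
    (Int.emod_lt_of_pos (f j - c) ha)
  rwa [show f i - f j = (f i - c) % a - (f j - c) % a by linarith]

theorem HasMonochromaticSubset.insert_of_link [DecidableEq α] {k p : ℕ} {x : α} {E : Finset α}
    {c : Set (Finset α)} (hx : x ∉ E)
    (hlink : ∀ u ∈ E.powersetCard k, insert x u ∈ c) (h : HasMonochromaticSubset (k + 1) p E c) :
    HasMonochromaticSubset (k + 1) (p + 1) (insert x E) c := by
  obtain ⟨E', hE', hp, hc⟩ := h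
  have hxE' : x ∉ E' := fun hx' => hx (hE' hx')
  refine ⟨insert x E', insert_subset_insert x hE', ?_, fun u hu => ?_⟩
  · rw [card_insert_of_notMem hxE']
    exact Nat.succ_le_succ hp
  · rw [powersetCard_succ_insert hxE', mem_union, mem_image] at hu
    rcases hu with hu | ⟨v, hv, rfl⟩
    · exact hc u hu
    · exact hlink v (powersetCard_mono hE' hv)

theorem RamseyBound.insert_of_link [DecidableEq α] {k p q N : ℕ}
    (h : RamseyBound α (k + 1) p q N) {x : α} {E : Finset α} (hx : x ∉ E)
    {c : Set (Finset α)} (hlink : HasMonochromaticSubset k N E {u | insert x u ∈ c}) :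
    HasMonochromaticSubset (k + 1) (p + 1) (insert x E) c ∨
      HasMonochromaticSubset (k + 1) q (insert x E) cᶜ := by
  obtain ⟨E', hE', hN, hc⟩ := hlink
  exact (h E' hN c).imp
    (fun hp => (hp.insert_of_link (fun hx' => hx (hE' hx')) hc).mono (insert_subset_insert x hE'))
    (fun hq => hq.mono (hE'.trans (subset_insert x E)))

theorem RamseyBound.succ {k p q N₁ N₂ N : ℕ} (h₁ : RamseyBound α (k + 1) p (q + 1) N₁)
    (h₂ : RamseyBound α (k + 1) (p + 1) q N₂) (h : RamseyBound α k N₁ N₂ N) :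
    RamseyBound α (k + 1) (p + 1) (q + 1) (N + 1) := by
  classical
  intro D hD c
  obtain ⟨x, hx⟩ : D.Nonempty := card_pos.1 (by omega)
  have hcard : N ≤ #(D.erase x) := by
    rw [card_erase_of_mem hx]
    omega
  rw [← insert_erase hx]
  rcases h (D.erase x) hcard {u | insert x u ∈ c} with hp | hq
  · exact h₁.insert_of_link (notMem_erase x D) hp
  · simpa only [compl_compl] using (h₂.symm.insert_of_link (c := cᶜ) (notMem_erase x D) hq).symm

theorem exists_ramseyBound (k p q : ℕ) : ∃ N, RamseyBound α k p q N := by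
  induction k generalizing p q with
  | zero =>
    refine ⟨max p q, fun E hE c => ?_⟩
    by_cases h : ∅ ∈ c
    · exact .inl ⟨E, subset_rfl, le_of_max_le_left hE, by simpa using h⟩
    · exact .inr ⟨E, subset_rfl, le_of_max_le_right hE, by simpa using h⟩
  | succ k ihk =>
    induction p generalizing q with
    | zero => exact ⟨0, fun E _ c => .inl ⟨∅, empty_subset E, le_rfl, by simp⟩⟩
    | succ p ihp =>
      induction q with
      | zero => exact ⟨0, fun E _ c => .inr ⟨∅, empty_subset E, le_rfl, by simp⟩⟩
      | succ q ihq =>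
        obtain ⟨N₁, h₁⟩ := ihp (q + 1)
        obtain ⟨N₂, h₂⟩ := ihq
        obtain ⟨N, h⟩ := ihk N₁ N₂
        exact ⟨N + 1, h₁.succ h₂ h⟩

theorem exists_exchange [DecidableEq α] {k : ℕ} {E u v : Finset α}
    (hu : u ∈ E.powersetCard k) (hv : v ∈ E.powersetCard k) (huv : u ≠ v) :
    ∃ w ∈ E.powersetCard k, #(symmDiff u w) ≤ 2 ∧ #(w \ v) + 1 = #(u \ v) := by
  rw [mem_powersetCard] at hu hv
  have hcard : #u = #v := hu.2.trans hv.2.symm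
  obtain ⟨x, hx⟩ : (u \ v).Nonempty :=
    sdiff_nonempty.2 fun h => huv (eq_of_subset_of_card_le h hcard.ge)
  obtain ⟨y, hy⟩ : (v \ u).Nonempty :=
    sdiff_nonempty.2 fun h => huv (eq_of_subset_of_card_le h hcard.le).symm
  rw [mem_sdiff] at hx hy
  have hyx : y ∉ u.erase x := fun h => hy.2 (mem_of_mem_erase h)
  refine ⟨insert y (u.erase x), mem_powersetCard.2 ⟨?_, ?_⟩, ?_, ?_⟩
  · exact insert_subset (hv.1 hy.1) ((erase_subset x u).trans hu.1)
  · rw [card_insert_of_notMem hyx, card_erase_add_one hx.1, hu.2]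
  · refine (card_le_card fun z hz => ?_).trans (card_le_two (a := x) (b := y))
    simp only [mem_symmDiff, mem_insert, mem_erase, mem_singleton] at hz ⊢
    tauto
  · rw [insert_sdiff_of_mem _ hy.1, erase_sdiff_comm, card_erase_add_one (mem_sdiff.2 hx)]

theorem abs_sub_le_card_sdiff_mul [DecidableEq α] {k : ℕ} {E : Finset α} {f : Finset α → ℤ} {a : ℤ}
    (hf : ∀ u ∈ E.powersetCard k, ∀ v ∈ E.powersetCard k, #(symmDiff u v) ≤ 2 → |f u - f v| ≤ a)
    {u v : Finset α} (hu : u ∈ E.powersetCard k) (hv : v ∈ E.powersetCard k) :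
    |f u - f v| ≤ #(u \ v) * a := by
  induction hn : #(u \ v) generalizing u with
  | zero =>
    have huv : u = v := eq_of_subset_of_card_le (sdiff_eq_empty_iff_subset.1 (card_eq_zero.1 hn))
      ((mem_powersetCard.1 hv).2.trans (mem_powersetCard.1 hu).2.symm).le
    simp [huv]
  | succ n ih =>
    obtain ⟨w, hw, huw, hwv⟩ := exists_exchange hu hv (by rintro rfl; simp at hn)
    calc |f u - f v| ≤ |f u - f w| + |f w - f v| := abs_sub_le _ _ _
      _ ≤ a + n * a := add_le_add (hf u hu w hw huw) (ih hw (by omega))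
      _ = (n + 1 : ℕ) * a := by push_cast; ring

theorem exists_disjoint_abs_sub_lt [DecidableEq α] {k : ℕ} {E : Finset α} {f : Finset α → ℤ}
    {a : ℤ} (hE : (2 * k + 2) * k ≤ #E)
    (hf : ∀ u ∈ E.powersetCard k, ∀ v ∈ E.powersetCard k, #(symmDiff u v) ≤ 2 → |f u - f v| < a) :
    ∃ u ∈ E.powersetCard k, ∃ v ∈ E.powersetCard k, Disjoint u v ∧ |f u - f v| < a := by
  obtain ⟨W, hW, hdisj⟩ := exists_pairwise_disjoint_powersetCard hE
  have ha : 0 < a := (abs_nonneg _).trans_lt (hf _ (hW 0) _ (hW 0) (by simp))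
  have hbound (i) : |f (W i) - f (W 0)| ≤ k * a := by
    refine (abs_sub_le_card_sdiff_mul (fun u hu v hv h => (hf u hu v hv h).le) (hW i) (hW 0)).trans
      (mul_le_mul_of_nonneg_right ?_ ha.le)
    exact_mod_cast (card_le_card sdiff_subset).trans (mem_powersetCard.1 (hW i)).2.le
  obtain ⟨i, j, hij, hlt⟩ := exists_ne_abs_sub_lt (ι := Fin (2 * k + 2)) ha hbound (by simp)
  exact ⟨W i, hW i, W j, hW j, hdisj hij, hlt⟩

end FiniteSets

/-! ## Rich and spread families of sets -/

section Families

variable {α : Type*}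

/-- `F` does not separate points of the family `Y`: it is contained in `Y` or disjoint from `Y`. -/
def IsHomogeneous (F Y : Set α) : Prop := ∀ u ∈ F, ∀ v ∈ F, u ∈ Y → v ∈ Y

theorem IsHomogeneous.mono {F F' Y : Set α} (h : IsHomogeneous F Y) (hF : F' ⊆ F) :
    IsHomogeneous F' Y :=
  fun u hu v hv => h u (hF hu) v (hF hv)

variable (α) in
/-- The sets with at most `n` elements. -/
def cardLE (n : ℕ) : Set (Set α) := {w | w.encard ≤ n}

variable (α) in
/-- The pairs of sets that differ at no more than `n` points. -/
def closeLE (n : ℕ) : Set (Set α × Set α) := {p | symmDiff p.1 p.2 ∈ cardLE α n}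

/-- The triples `((y, z), a)` with `|y - z| < a`. -/
def distLT : Set ((ℕ × ℕ) × ℕ) := {r | |(r.1.1 : ℤ) - r.1.2| < r.2}

variable (α) in
/-- Two points `(u, y)`, `(v, z)` of a relation together with a bound `a` such that `u` and `v`
differ by at most one exchange and yet `|y - z| ≥ a`. -/
def torn : Set (((Set α × ℕ) × (Set α × ℕ)) × ℕ) :=
  {r | (r.1.1.1, r.1.2.1) ∈ closeLE α 2 ∧ ((r.1.1.2, r.1.2.2), r.2) ∉ distLT}

variable (α) in
/-- Two points `(u, y)`, `(v, z)` of a relation together with a bound `a` such that `u` and `v`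
differ at more than `K` points and yet `|y - z| < a`. -/
def glued (K : ℕ) : Set (((Set α × ℕ) × (Set α × ℕ)) × ℕ) :=
  {r | (r.1.1.1, r.1.2.1) ∉ closeLE α K ∧ ((r.1.1.2, r.1.2.2), r.2) ∈ distLT}

variable (α) in
/-- The families containing all `k`-element subsets of some set with at least `p` elements. -/
def rich (k p : ℕ) : Set (Set (Set α)) :=
  {F | ∃ E : Finset α, p ≤ E.card ∧ ∀ u ∈ E.powersetCard k, (u : Set α) ∈ F}

variable (α) in
/-- The families on which no relation with values in `ℕ` can be total without tearing a pair or
gluing two sets that differ at more than `K` points, whatever the bound `a`. -/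
def spread (K : ℕ) : Set (Set (Set α)) :=
  {F | ∀ (G : Set (Set α × ℕ)) (a : ℕ), (∀ u ∈ F, ∃ y, (u, y) ∈ G) →
    (∀ p ∈ G, ∀ q ∈ G, ((p, q), a) ∉ torn α) → ∃ p ∈ G, ∃ q ∈ G, ((p, q), a) ∈ glued α K}

theorem mem_symmDiff_iff_not_iff {s t : Set α} {x : α} :
    x ∈ symmDiff s t ↔ ¬ (x ∈ s ↔ x ∈ t) := by
  rw [Set.mem_symmDiff]
  tauto

theorem mem_cardLE_zero {w : Set α} : w ∈ cardLE α 0 ↔ ∀ x, x ∉ w := by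
  simp [cardLE, Set.eq_empty_iff_forall_notMem]

theorem mem_cardLE_succ {w : Set α} {n : ℕ} :
    w ∈ cardLE α (n + 1) ↔ ∀ x ∈ w, w \ {x} ∈ cardLE α n := by
  simp only [cardLE, Set.mem_ofPred_eq, Nat.cast_succ]
  refine ⟨fun h x hx => ?_, fun h => ?_⟩
  · rw [← Set.encard_sdiff_singleton_add_one hx] at h
    exact (ENat.add_le_add_iff_right ENat.one_ne_top).1 h
  · obtain rfl | ⟨x, hx⟩ := w.eq_empty_or_nonempty
    · simp
    · rw [← Set.encard_sdiff_singleton_add_one hx]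
      gcongr
      exact h x hx

theorem mem_closeLE_iff_mem_cardLE {n : ℕ} {u v w : Set α} (hw : ∀ x, x ∈ w ↔ ¬ (x ∈ u ↔ x ∈ v)) :
    (u, v) ∈ closeLE α n ↔ w ∈ cardLE α n := by
  rw [show w = symmDiff u v from Set.ext fun x => (hw x).trans mem_symmDiff_iff_not_iff.symm]
  rfl

theorem exists_mem_closeLE_iff_finite {u v : Set α} :
    (∃ n, (u, v) ∈ closeLE α n) ↔ (symmDiff u v).Finite :=
  ⟨fun ⟨_, hn⟩ => Set.finite_of_encard_le_coe hn, fun h =>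
    ⟨_, h.encard_eq_coe_toFinset_card.le⟩⟩

theorem mem_distLT {y z a : ℕ} :
    ((y, z), a) ∈ distLT ↔ ∃ d : ℕ, d < a ∧ (d : ℤ) = |(y : ℤ) - z| := by
  refine ⟨fun h : |(y : ℤ) - z| < a => ⟨|(y : ℤ) - z|.toNat, ?_, ?_⟩, ?_⟩
  · exact (Int.toNat_lt (abs_nonneg _)).2 h
  · exact Int.toNat_of_nonneg (abs_nonneg _)
  · rintro ⟨d, hda, hd⟩
    exact hd.symm.trans_lt (Nat.cast_lt.2 hda)

theorem cardLE_mono : Monotone (cardLE α) :=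
  fun _ _ h w (hw : w.encard ≤ _) => hw.trans (Nat.cast_le.2 h)

theorem glued_anti : Antitone (glued α) :=
  fun _ _ h _ hr => ⟨fun hclose => hr.1 (cardLE_mono h hclose), hr.2⟩

theorem torn_anti {r : (Set α × ℕ) × (Set α × ℕ)} {a b : ℕ} (hab : a < b)
    (hr : (r, b) ∈ torn α) : (r, a) ∈ torn α :=
  ⟨hr.1, fun h : |_| < (a : ℤ) => hr.2 (h.trans (Nat.cast_lt.2 hab))⟩

theorem spread_anti : Antitone (spread α) := fun _ _ h _ hF G a htotal htorn =>
  let ⟨p, hp, q, hq, hpq⟩ := hF G a htotal htorn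
  ⟨p, hp, q, hq, glued_anti h hpq⟩

theorem nonempty_of_mem_spread {K : ℕ} {F : Set (Set α)} (hF : F ∈ spread α K) : F.Nonempty := by
  by_contra! rfl
  obtain ⟨p, hp, -⟩ := hF ∅ 0 (by simp) (by simp)
  exact hp

theorem powerset_mem_rich (k : ℕ) {p : ℕ} {D : Set α} (hD : D ∉ cardLE α p) :
    𝒫 D ∈ rich α k p := by
  obtain ⟨E, hED, hE⟩ := Set.exists_subset_encard_eq (not_le.1 hD).le
  have hfin : E.Finite := Set.finite_of_encard_eq_coe hE
  refine ⟨hfin.toFinset, ?_, fun u hu x hx => hED ?_⟩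
  · rw [hfin.encard_eq_coe_toFinset_card, Nat.cast_inj] at hE
    exact hE.ge
  · exact hfin.mem_toFinset.1 ((Finset.mem_powersetCard.1 hu).1 hx)

theorem exists_rich_isHomogeneous (k p : ℕ) : ∃ N, ∀ F ∈ rich α k N, ∀ Y : Set (Set α),
    ∃ F' ∈ rich α k p, F' ⊆ F ∧ IsHomogeneous F' Y := by
  classical
  obtain ⟨N, hN⟩ := exists_ramseyBound (α := α) k p p
  refine ⟨N, fun F ⟨E, hE, hF⟩ Y => ?_⟩
  obtain ⟨E', hE', hp, hY⟩ : ∃ E' ⊆ E, p ≤ E'.card ∧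
      ∀ u ∈ E'.powersetCard k, ∀ v ∈ E'.powersetCard k, (u : Set α) ∈ Y → (v : Set α) ∈ Y := by
    rcases hN E hE {u | (u : Set α) ∈ Y} with ⟨E', hE', hp, hY⟩ | ⟨E', hE', hp, hY⟩
    · exact ⟨E', hE', hp, fun _ _ v hv _ => hY v hv⟩
    · exact ⟨E', hE', hp, fun u hu _ _ huY => absurd huY (hY u hu)⟩
  refine ⟨(↑) '' (E'.powersetCard k : Set (Finset α)),
    ⟨E', hp, fun u hu => Set.mem_image_of_mem _ hu⟩, ?_, ?_⟩
  · rintro _ ⟨u, hu, rfl⟩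
    exact hF u (Finset.powersetCard_mono hE' hu)
  · rintro _ ⟨u, hu, rfl⟩ _ ⟨v, hv, rfl⟩
    exact hY u hu v hv

theorem rich_subset_spread (K : ℕ) :
    rich α (K + 1) ((2 * (K + 1) + 2) * (K + 1)) ⊆ spread α K := by
  classical
  rintro F ⟨E, hE, hF⟩ G a htotal htorn
  choose! y hy using htotal
  obtain ⟨u, hu, v, hv, huv, hlt⟩ := exists_disjoint_abs_sub_lt hE
    (f := fun u => (y u : ℤ)) (a := a) fun u hu v hv hclose => by
      by_contra hfar
      refine htorn (u, y u) (hy u (hF u hu)) (v, y v) (hy v (hF v hv)) ⟨?_, hfar⟩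
      change (symmDiff (u : Set α) v).encard ≤ _
      rw [← Finset.coe_symmDiff, Set.encard_coe_eq_coe_finsetCard]
      exact_mod_cast hclose
  refine ⟨(u, y u), hy u (hF u hu), (v, y v), hy v (hF v hv), fun hclose => ?_, hlt⟩
  have hle : (u : Set α).encard ≤ K :=
    (Set.encard_le_encard fun x hx => .inl ⟨hx, Finset.disjoint_left.1 huv hx⟩).trans hclose
  rw [Set.encard_coe_eq_coe_finsetCard, (Finset.mem_powersetCard.1 hu).2, Nat.cast_le] at hle
  omega

end Families

local notation "v₀" => Term.var Var.zero
local notation "v₁" => Term.var Var.zero.succ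
local notation "v₂" => Term.var Var.zero.succ.succ
local notation "v₃" => Term.var Var.zero.succ.succ.succ
local notation "v₄" => Term.var Var.zero.succ.succ.succ.succ
local notation "v₅" => Term.var Var.zero.succ.succ.succ.succ.succ
local notation "v₆" => Term.var Var.zero.succ.succ.succ.succ.succ.succ
local notation "v₇" => Term.var Var.zero.succ.succ.succ.succ.succ.succ.succ

/-! ## Formulas -/

namespace Formula

/-- Implication, in terms of the primitive connectives. -/
def imp {Γ : List Ty} (φ ψ : Formula Γ) : Formula Γ := .not (.and φ (.not ψ))

/-- Equivalence, in terms of the primitive connectives. -/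
def iff {Γ : List Ty} (φ ψ : Formula Γ) : Formula Γ := .and (imp φ ψ) (imp ψ φ)

/-- Existential quantification, in terms of the primitive connectives. -/
def ex {Γ : List Ty} (τ : Ty) (φ : Formula (τ :: Γ)) : Formula Γ := .not (.all τ (.not φ))

variable {S : TypedStructure.{u}} {Γ : List Ty}

theorem holds_imp (φ ψ : Formula Γ) (ρ : Env S Γ) :
    (imp φ ψ).Holds ρ ↔ (φ.Holds ρ → ψ.Holds ρ) := by
  simp only [imp, Holds, not_and, not_not]

theorem holds_iff (φ ψ : Formula Γ) (ρ : Env S Γ) :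
    (iff φ ψ).Holds ρ ↔ (φ.Holds ρ ↔ ψ.Holds ρ) := by
  simp only [iff, Holds, holds_imp, iff_def]

theorem holds_ex (τ : Ty) (φ : Formula (τ :: Γ)) (ρ : Env S Γ) :
    (ex τ φ).Holds ρ ↔ ∃ a : S.Obj τ, φ.Holds (Env.cons a ρ) := by
  simp only [ex, Holds, not_forall, not_not]

end Formula

section Renaming

variable {S : TypedStructure.{u}} {Γ Δ : List Ty}

/-- The extension of a renaming of variables to the context under a quantifier. -/
def Var.liftRen {σ : Ty} (r : ∀ τ, Var Γ τ → Var Δ τ) : ∀ τ, Var (σ :: Γ) τ → Var (σ :: Δ) τ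
  | _, .zero => .zero
  | _, .succ v => .succ (r _ v)

/-- The term obtained by renaming the variables. -/
def Term.ren (r : ∀ τ, Var Γ τ → Var Δ τ) : {τ : Ty} → Term Γ τ → Term Δ τ
  | _, .var v => .var (r _ v)
  | _, .pair s t => .pair (s.ren r) (t.ren r)

/-- The formula obtained by renaming the free variables. -/
def Formula.ren : {Γ Δ : List Ty} → (∀ τ, Var Γ τ → Var Δ τ) → Formula Γ → Formula Δ
  | _, _, r, .eq s t => .eq (s.ren r) (t.ren r)
  | _, _, r, .mem s t => .mem (s.ren r) (t.ren r)
  | _, _, r, .not φ => .not (φ.ren r)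
  | _, _, r, .and φ ψ => .and (φ.ren r) (ψ.ren r)
  | _, _, r, .all τ φ => .all τ (φ.ren (Var.liftRen r))

theorem Term.eval_ren (r : ∀ τ, Var Γ τ → Var Δ τ) (ρ : Env S Δ) {τ : Ty} (t : Term Γ τ) :
    (t.ren r).eval ρ = t.eval (fun τ v => ρ τ (r τ v)) := by
  induction t with
  | var v => rfl
  | pair s t hs ht => simp only [Term.ren, Term.eval, hs, ht]

theorem Env.cons_liftRen {σ : Ty} (r : ∀ τ, Var Γ τ → Var Δ τ) (ρ : Env S Δ) (a : S.Obj σ) :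
    (fun τ v => Env.cons a ρ τ (Var.liftRen r τ v)) = Env.cons a (fun τ v => ρ τ (r τ v)) := by
  funext τ v
  cases v <;> rfl

theorem Formula.holds_ren (r : ∀ τ, Var Γ τ → Var Δ τ) (φ : Formula Γ) (ρ : Env S Δ) :
    (φ.ren r).Holds ρ ↔ φ.Holds (fun τ v => ρ τ (r τ v)) := by
  induction φ generalizing Δ with
  | eq s t => simp only [Formula.ren, Formula.Holds, Term.eval_ren]
  | mem s t => simp only [Formula.ren, Formula.Holds, Term.eval_ren]
  | not φ ih => simp only [Formula.ren, Formula.Holds, ih]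
  | and φ ψ ih ih' => simp only [Formula.ren, Formula.Holds, ih, ih']
  | all τ φ ih => simp only [Formula.ren, Formula.Holds, ih, Env.cons_liftRen]

/-- The formula saying that there is a set whose elements are the solutions of `φ`. -/
def Formula.comprehension {τ : Ty} (φ : Formula (τ :: Γ)) : Formula Γ :=
  .ex (.set τ) (.all τ (.iff (.mem v₀ v₁) (φ.ren (Var.liftRen fun _ v => .succ v))))

theorem Formula.holds_comprehension {τ : Ty} (φ : Formula (τ :: Γ)) (ρ : Env S Γ) :
    φ.comprehension.Holds ρ ↔
      ∃ A : S.Obj (.set τ), ∀ x, S.mem x A ↔ φ.Holds (Env.cons x ρ) := by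
  simp only [Formula.comprehension, Formula.holds_ex, Formula.Holds, Formula.holds_iff,
    Formula.holds_ren, Env.cons_liftRen]
  rfl

end Renaming

section Closure

variable {S : TypedStructure.{u}} {Γ : List Ty}

/-- The universal closure of a formula. -/
def Formula.close : (Γ : List Ty) → Formula Γ → Formula []
  | [], φ => φ
  | τ :: Γ, φ => Formula.close Γ (.all τ φ)

/-- The empty assignment. -/
def Env.nil : Env S [] := fun _ v => nomatch v

theorem Env.eq_nil (ρ : Env S []) : ρ = Env.nil := by
  funext τ v
  cases v

theorem Env.eq_cons {σ : Ty} (ρ : Env S (σ :: Γ)) :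
    ρ = Env.cons (ρ σ .zero) (fun τ v => ρ τ (.succ v)) := by
  funext τ v
  cases v <;> rfl

theorem Formula.holds_close (φ : Formula Γ) (ρ₀ : Env S []) :
    (Formula.close Γ φ).Holds ρ₀ ↔ ∀ ρ : Env S Γ, φ.Holds ρ := by
  induction Γ with
  | nil => exact ⟨fun h ρ => by rwa [Env.eq_nil ρ, ← Env.eq_nil ρ₀], fun h => h ρ₀⟩
  | cons τ Γ ih =>
    rw [Formula.close, ih]
    refine ⟨fun h ρ => ?_, fun h ρ a => h _⟩
    rw [Env.eq_cons ρ]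
    exact h _ _

end Closure

/-- The type of the triples `((p, q), a)` of `torn` and `glued` for sets of objects of type `τ`. -/
abbrev Ty.comparison (τ : Ty) : Ty :=
  .prod (.prod (.prod (.set τ) .nat) (.prod (.set τ) .nat)) .nat

namespace Universe

variable {M : Universe.{u}}

theorem holds_of_forall_standard {Γ : List Ty} (φ : Formula Γ)
    (h : ∀ ρ : Env standard Γ, φ.Holds ρ) (ρ : Env M.toTypedStructure Γ) : φ.Holds ρ :=
  (φ.holds_close _).1 ((M.transfer (Formula.close Γ φ) Env.nil).1 ((φ.holds_close _).2 h)) ρ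

/-! ## Internal sets -/

/-- The internal sets, as sets of internal objects. -/
def IsInternal {τ : Ty} (X : Set (M.Obj τ)) : Prop := ∃ A : M.Obj (.set τ), M.elems A = X

theorem isInternal_elems {τ : Ty} (A : M.Obj (.set τ)) : IsInternal (M.elems A) := ⟨A, rfl⟩

theorem isInternal_setOf_holds {Γ : List Ty} {τ : Ty} (φ : Formula (τ :: Γ))
    (ρ : Env M.toTypedStructure Γ) : IsInternal {x | φ.Holds (Env.cons x ρ)} := by
  obtain ⟨A, hA⟩ := (φ.holds_comprehension ρ).1 <| holds_of_forall_standard _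
    (fun ρ' => (φ.holds_comprehension ρ').2
      ⟨{x | φ.Holds (S := standard) (Env.cons x ρ')}, fun _ => Iff.rfl⟩) ρ
  exact ⟨A, Set.ext hA⟩

namespace IsInternal

variable {σ τ : Ty}

theorem compl {X : Set (M.Obj τ)} (hX : IsInternal X) : IsInternal Xᶜ := by
  obtain ⟨A, rfl⟩ := hX
  exact isInternal_setOf_holds (.not (.mem v₀ v₁)) (Env.cons A Env.nil)

theorem inter {X Y : Set (M.Obj τ)} (hX : IsInternal X) (hY : IsInternal Y) :
    IsInternal (X ∩ Y) := by
  obtain ⟨A, rfl⟩ := hX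
  obtain ⟨B, rfl⟩ := hY
  exact isInternal_setOf_holds (.and (.mem v₀ v₁) (.mem v₀ v₂))
    (Env.cons A (Env.cons B Env.nil))

theorem symmDiff {X Y : Set (M.Obj τ)} (hX : IsInternal X) (hY : IsInternal Y) :
    IsInternal (symmDiff X Y) := by
  have h := ((hX.inter hY.compl).compl.inter (hY.inter hX.compl).compl).compl
  rwa [← Set.compl_union, compl_compl] at h

theorem preimage_pair {X : Set (M.Obj (.prod σ τ))} (hX : IsInternal X) (u : M.Obj σ) :
    IsInternal {y | M.pair u y ∈ X} := by
  obtain ⟨A, rfl⟩ := hX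
  exact isInternal_setOf_holds (.mem (.pair v₁ v₀) v₂)
    (Env.cons u (Env.cons A Env.nil))

end IsInternal

variable {σ τ : Ty}

/-! ## Extensions of standard sets -/

variable (M) in
/-- The nonstandard extension of a standard set, as a set of internal objects. -/
def starSet (A : Set τ.Std) : Set (M.Obj τ) := M.elems (M.star (τ := .set τ) A)

theorem starSet_mono {A B : Set τ.Std} (h : A ⊆ B) : M.starSet A ⊆ M.starSet B := by
  have transferred := (M.transfer (.all τ (.imp (.mem v₀ v₁) (.mem v₀ v₂)))
    (Env.cons (σ := .set τ) A (Env.cons (σ := .set τ) B Env.nil))).1 <| by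
    simp only [Formula.Holds, Formula.holds_imp]
    exact fun _ hx => h hx
  simp only [Formula.Holds, Formula.holds_imp] at transferred
  exact transferred

theorem mem_starSet_cardLE_zero {w : M.Obj (.set τ)} :
    w ∈ M.starSet (τ := .set τ) (cardLE τ.Std 0) ↔ ∀ x, x ∉ M.elems w := by
  have transferred := (M.transfer (.all (.set τ) (.iff (.mem v₀ v₁) (.all τ (.not (.mem v₀ v₁)))))
    (Env.cons (σ := .set (.set τ)) (cardLE τ.Std 0) Env.nil)).1 <| by
    simp only [Formula.Holds, Formula.holds_iff]
    exact fun _ => mem_cardLE_zero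
  simp only [Formula.Holds, Formula.holds_iff] at transferred
  exact transferred w

theorem mem_starSet_cardLE_succ {n : ℕ} {w : M.Obj (.set τ)} :
    w ∈ M.starSet (τ := .set τ) (cardLE τ.Std (n + 1)) ↔
      ∀ x ∈ M.elems w, ∀ w', (∀ z, z ∈ M.elems w' ↔ z ∈ M.elems w ∧ z ≠ x) →
        w' ∈ M.starSet (τ := .set τ) (cardLE τ.Std n) := by
  have transferred := (M.transfer (.all (.set τ) (.iff (.mem v₀ v₂) (.all τ (.imp (.mem v₀ v₁)
    (.all (.set τ) (.imp (.all τ (.iff (.mem v₀ v₁) (.and (.mem v₀ v₃) (.not (.eq v₀ v₂)))))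
      (.mem v₀ v₃)))))))
    (Env.cons (σ := .set (.set τ)) (cardLE τ.Std n)
      (Env.cons (σ := .set (.set τ)) (cardLE τ.Std (n + 1)) Env.nil))).1 <| by
    simp only [Formula.Holds, Formula.holds_iff, Formula.holds_imp]
    refine fun w => mem_cardLE_succ.trans (forall₂_congr fun x _ => ?_)
    exact ⟨fun h w' hw' => (Set.ext hw' : w' = _) ▸ h, fun h => h _ fun _ => Iff.rfl⟩
  simp only [Formula.Holds, Formula.holds_iff, Formula.holds_imp] at transferred
  exact transferred w

theorem isInternal_sdiff_singleton (w : M.Obj (.set τ)) (x : M.Obj τ) :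
    IsInternal (M.elems w \ {x}) :=
  isInternal_setOf_holds (.and (.mem v₀ v₁) (.not (.eq v₀ v₂))) (Env.cons w (Env.cons x Env.nil))

theorem mem_starSet_cardLE {n : ℕ} {w : M.Obj (.set τ)} :
    w ∈ M.starSet (τ := .set τ) (cardLE τ.Std n) ↔ M.elems w ∈ cardLE (M.Obj τ) n := by
  induction n generalizing w with
  | zero => exact mem_starSet_cardLE_zero.trans mem_cardLE_zero.symm
  | succ n ih =>
    rw [mem_starSet_cardLE_succ, mem_cardLE_succ]
    refine forall₂_congr fun x _ => ⟨fun h => ?_, fun h w' hw' => ih.2 ?_⟩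
    · obtain ⟨w', hw'⟩ := isInternal_sdiff_singleton w x
      exact hw' ▸ ih.1 (h w' (Set.ext_iff.1 hw'))
    · exact (Set.ext hw' : M.elems w' = _) ▸ h

theorem mem_starSet_closeLE_iff_cardLE {n : ℕ} {u v w : M.Obj (.set τ)}
    (hw : ∀ x, x ∈ M.elems w ↔ ¬ (x ∈ M.elems u ↔ x ∈ M.elems v)) :
    M.pair u v ∈ M.starSet (τ := .prod (.set τ) (.set τ)) (closeLE τ.Std n) ↔
      w ∈ M.starSet (τ := .set τ) (cardLE τ.Std n) := by
  have transferred := (M.transfer (.all (.set τ) (.all (.set τ) (.all (.set τ) (.imp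
    (.all τ (.iff (.mem v₀ v₁) (.not (.iff (.mem v₀ v₃) (.mem v₀ v₂)))))
    (.iff (.mem (.pair v₂ v₁) v₃) (.mem v₀ v₄))))))
    (Env.cons (σ := .set (.prod (.set τ) (.set τ))) (closeLE τ.Std n)
      (Env.cons (σ := .set (.set τ)) (cardLE τ.Std n) Env.nil))).1 <| by
    simp only [Formula.Holds, Formula.holds_iff, Formula.holds_imp]
    exact fun _ _ _ hw => mem_closeLE_iff_mem_cardLE hw
  simp only [Formula.Holds, Formula.holds_iff, Formula.holds_imp] at transferred
  exact transferred u v w hw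

theorem mem_starSet_closeLE {n : ℕ} {u v : M.Obj (.set τ)} :
    M.pair u v ∈ M.starSet (τ := .prod (.set τ) (.set τ)) (closeLE τ.Std n) ↔
      (M.elems u, M.elems v) ∈ closeLE (M.Obj τ) n := by
  obtain ⟨w, hw⟩ := (isInternal_elems u).symmDiff (isInternal_elems v)
  have hw' (x) := (Set.ext_iff.1 hw x).trans mem_symmDiff_iff_not_iff
  rw [mem_starSet_closeLE_iff_cardLE hw', mem_starSet_cardLE, mem_closeLE_iff_mem_cardLE hw']

variable (M) in
/-- The relation `|y - z| < a` between hypernatural numbers. -/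
def DistLt (y z a : M.HyperNat) : Prop := ∃ d, M.Lt d a ∧ M.IsAbsDiff y z d

theorem mem_starSet_distLT {y z a : M.HyperNat} :
    M.pair (M.pair y z) a ∈ M.starSet (τ := .prod (.prod .nat .nat) .nat) distLT ↔
      M.DistLt y z a := by
  have transferred := (M.transfer (.all .nat (.all .nat (.all .nat (.iff
    (.mem (.pair (.pair v₂ v₁) v₀) v₃)
    (.ex .nat (.and (.mem (.pair v₀ v₁) v₅) (.mem (.pair (.pair v₃ v₂) v₀) v₆)))))))
    (Env.cons (σ := .set (.prod (.prod .nat .nat) .nat)) distLT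
      (Env.cons (σ := .set (.prod .nat .nat)) {p : ℕ × ℕ | p.1 < p.2}
        (Env.cons (σ := .set (.prod (.prod .nat .nat) .nat))
          {p : (ℕ × ℕ) × ℕ | (p.2 : ℤ) = |(p.1.1 : ℤ) - (p.1.2 : ℤ)|} Env.nil)))).1 <| by
    simp only [Formula.Holds, Formula.holds_iff, Formula.holds_ex]
    exact fun _ _ _ => mem_distLT
  simp only [Formula.Holds, Formula.holds_iff, Formula.holds_ex] at transferred
  exact transferred y z a

section Comparison

variable {u v : M.Obj (.set τ)} {y z a b : M.HyperNat}

theorem mem_starSet_torn :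
    M.pair (M.pair (M.pair u y) (M.pair v z)) a ∈ M.starSet (τ := τ.comparison) (torn τ.Std) ↔
      (M.elems u, M.elems v) ∈ closeLE (M.Obj τ) 2 ∧ ¬ M.DistLt y z a := by
  have transferred := (M.transfer (.all (.set τ) (.all .nat (.all (.set τ) (.all .nat (.all .nat
    (.iff (.mem (.pair (.pair (.pair v₄ v₃) (.pair v₂ v₁)) v₀) v₅)
      (.and (.mem (.pair v₄ v₂) v₆) (.not (.mem (.pair (.pair v₃ v₁) v₀) v₇)))))))))
    (Env.cons (σ := .set τ.comparison) (torn τ.Std)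
      (Env.cons (σ := .set (.prod (.set τ) (.set τ))) (closeLE τ.Std 2)
        (Env.cons (σ := .set (.prod (.prod .nat .nat) .nat)) distLT Env.nil)))).1 <| by
    simp only [Formula.Holds, Formula.holds_iff]
    exact fun _ _ _ _ _ => Iff.rfl
  simp only [Formula.Holds, Formula.holds_iff] at transferred
  exact (transferred u y v z a).trans
    (and_congr mem_starSet_closeLE (not_congr mem_starSet_distLT))

theorem mem_starSet_glued {K : ℕ} :
    M.pair (M.pair (M.pair u y) (M.pair v z)) a ∈ M.starSet (τ := τ.comparison) (glued τ.Std K) ↔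
      (M.elems u, M.elems v) ∉ closeLE (M.Obj τ) K ∧ M.DistLt y z a := by
  have transferred := (M.transfer (.all (.set τ) (.all .nat (.all (.set τ) (.all .nat (.all .nat
    (.iff (.mem (.pair (.pair (.pair v₄ v₃) (.pair v₂ v₁)) v₀) v₅)
      (.and (.not (.mem (.pair v₄ v₂) v₆)) (.mem (.pair (.pair v₃ v₁) v₀) v₇))))))))
    (Env.cons (σ := .set τ.comparison) (glued τ.Std K)
      (Env.cons (σ := .set (.prod (.set τ) (.set τ))) (closeLE τ.Std K)
        (Env.cons (σ := .set (.prod (.prod .nat .nat) .nat)) distLT Env.nil)))).1 <| by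
    simp only [Formula.Holds, Formula.holds_iff]
    exact fun _ _ _ _ _ => Iff.rfl
  simp only [Formula.Holds, Formula.holds_iff] at transferred
  exact (transferred u y v z a).trans
    (and_congr (not_congr mem_starSet_closeLE) mem_starSet_distLT)

theorem pair_mem_starSet_torn_of_lt {r : M.Obj (.prod (.prod (.set τ) .nat) (.prod (.set τ) .nat))}
    (hab : M.Lt a b) (hr : M.pair r b ∈ M.starSet (τ := τ.comparison) (torn τ.Std)) :
    M.pair r a ∈ M.starSet (τ := τ.comparison) (torn τ.Std) := by
  have transferred := (M.transfer (.all (.prod (.prod (.set τ) .nat) (.prod (.set τ) .nat))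
    (.all .nat (.all .nat (.imp (.mem (.pair v₁ v₀) v₄)
      (.imp (.mem (.pair v₂ v₀) v₃) (.mem (.pair v₂ v₁) v₃))))))
    (Env.cons (σ := .set τ.comparison) (torn τ.Std)
      (Env.cons (σ := .set (.prod .nat .nat)) {p : ℕ × ℕ | p.1 < p.2} Env.nil))).1 <| by
    simp only [Formula.Holds, Formula.holds_imp]
    exact fun _ _ _ hab hr => torn_anti hab hr
  simp only [Formula.Holds, Formula.holds_imp] at transferred
  exact transferred r a b hab hr

end Comparison

/-! ## Spread and rich families in the universe -/

theorem nonempty_of_mem_starSet_spread {K : ℕ} {F : M.Obj (.set (.set τ))}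
    (hF : F ∈ M.starSet (τ := .set (.set τ)) (spread τ.Std K)) : (M.elems F).Nonempty := by
  have transferred := (M.transfer (.all (.set (.set τ))
    (.imp (.mem v₀ v₁) (.ex (.set τ) (.mem v₀ v₁))))
    (Env.cons (σ := .set (.set (.set τ))) (spread τ.Std K) Env.nil)).1 <| by
    simp only [Formula.Holds, Formula.holds_imp, Formula.holds_ex]
    exact fun _ hF => nonempty_of_mem_spread hF
  simp only [Formula.Holds, Formula.holds_imp, Formula.holds_ex] at transferred
  exact transferred F hF

theorem exists_mem_glued_of_mem_starSet_spread {K : ℕ} {F : M.Obj (.set (.set τ))}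
    (hF : F ∈ M.starSet (τ := .set (.set τ)) (spread τ.Std K))
    {G : Set (M.Obj (.prod (.set τ) .nat))} (hG : IsInternal G) (a : M.HyperNat)
    (htotal : ∀ u ∈ M.elems F, ∃ y, M.pair u y ∈ G)
    (htorn : ∀ p ∈ G, ∀ q ∈ G,
      M.pair (M.pair p q) a ∉ M.starSet (τ := τ.comparison) (torn τ.Std)) :
    ∃ p ∈ G, ∃ q ∈ G, M.pair (M.pair p q) a ∈ M.starSet (τ := τ.comparison) (glued τ.Std K) := by
  have transferred := (M.transfer (.all (.set (.set τ)) (.imp (.mem v₀ v₁)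
    (.all (.set (.prod (.set τ) .nat)) (.all .nat
      (.imp (.all (.set τ) (.imp (.mem v₀ v₃) (.ex .nat (.mem (.pair v₁ v₀) v₃))))
      (.imp (.all (.prod (.set τ) .nat) (.imp (.mem v₀ v₂) (.all (.prod (.set τ) .nat)
        (.imp (.mem v₀ v₃) (.not (.mem (.pair (.pair v₁ v₀) v₂) v₆))))))
      (.ex (.prod (.set τ) .nat) (.and (.mem v₀ v₂) (.ex (.prod (.set τ) .nat)
        (.and (.mem v₀ v₃) (.mem (.pair (.pair v₁ v₀) v₂) v₇)))))))))))
    (Env.cons (σ := .set (.set (.set τ))) (spread τ.Std K)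
      (Env.cons (σ := .set τ.comparison) (torn τ.Std)
        (Env.cons (σ := .set τ.comparison) (glued τ.Std K) Env.nil)))).1 <| by
    simp only [Formula.Holds, Formula.holds_imp, Formula.holds_ex]
    exact fun _ hF => hF
  simp only [Formula.Holds, Formula.holds_imp, Formula.holds_ex] at transferred
  obtain ⟨A, rfl⟩ := hG
  exact transferred F hF A a htotal htorn

theorem mem_starSet_rich_of_elems_eq_internalSubsets (k p : ℕ) {D : M.Obj (.set τ)}
    (hD : (M.elems D).Infinite) {P : M.Obj (.set (.set τ))}
    (hP : M.elems P = M.internalSubsets D) :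
    P ∈ M.starSet (τ := .set (.set τ)) (rich τ.Std k p) := by
  have transferred := (M.transfer (.all (.set τ) (.all (.set (.set τ)) (.imp
    (.all (.set τ) (.iff (.mem v₀ v₁) (.all τ (.imp (.mem v₀ v₁) (.mem v₀ v₃)))))
    (.imp (.not (.mem v₁ v₂)) (.mem v₀ v₃)))))
    (Env.cons (σ := .set (.set τ)) (cardLE τ.Std p)
      (Env.cons (σ := .set (.set (.set τ))) (rich τ.Std k p) Env.nil))).1 <| by
    simp only [Formula.Holds, Formula.holds_imp, Formula.holds_iff]
    exact fun _ _ hP hD => (Set.ext hP : _ = 𝒫 _) ▸ powerset_mem_rich k hD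
  simp only [Formula.Holds, Formula.holds_imp, Formula.holds_iff] at transferred
  refine transferred D P (Set.ext_iff.1 hP) fun hcard => hD ?_
  exact Set.finite_of_encard_le_coe (mem_starSet_cardLE.1 hcard)

theorem exists_starSet_rich_isHomogeneous (τ : Ty) (k p : ℕ) :
    ∃ N, ∀ F ∈ M.starSet (τ := .set (.set τ)) (rich τ.Std k N), ∀ Y : M.Obj (.set (.set τ)),
      ∃ F' ∈ M.starSet (τ := .set (.set τ)) (rich τ.Std k p),
        M.elems F' ⊆ M.elems F ∧ IsHomogeneous (M.elems F') (M.elems Y) := by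
  obtain ⟨N, hN⟩ := exists_rich_isHomogeneous (α := τ.Std) k p
  have transferred := (M.transfer (.all (.set (.set τ)) (.imp (.mem v₀ v₁) (.all (.set (.set τ))
    (.ex (.set (.set τ)) (.and (.mem v₀ v₄)
      (.and (.all (.set τ) (.imp (.mem v₀ v₁) (.mem v₀ v₃)))
        (.all (.set τ) (.imp (.mem v₀ v₁) (.all (.set τ) (.imp (.mem v₀ v₂)
          (.imp (.mem v₁ v₃) (.mem v₀ v₃))))))))))))
    (Env.cons (σ := .set (.set (.set τ))) (rich τ.Std k N)
      (Env.cons (σ := .set (.set (.set τ))) (rich τ.Std k p) Env.nil))).1 <| by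
    simp only [Formula.Holds, Formula.holds_imp, Formula.holds_ex]
    exact hN
  simp only [Formula.Holds, Formula.holds_imp, Formula.holds_ex] at transferred
  exact ⟨N, transferred⟩

theorem exists_starSet_rich_forall_isHomogeneous (τ : Ty) (k p m : ℕ) :
    ∃ N, ∀ F ∈ M.starSet (τ := .set (.set τ)) (rich τ.Std k N), ∀ Y : ℕ → M.Obj (.set (.set τ)),
      ∃ F' ∈ M.starSet (τ := .set (.set τ)) (rich τ.Std k p),
        M.elems F' ⊆ M.elems F ∧ ∀ i < m, IsHomogeneous (M.elems F') (M.elems (Y i)) := by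
  induction m with
  | zero => exact ⟨p, fun F hF _ => ⟨F, hF, subset_rfl, by simp⟩⟩
  | succ m ih =>
    obtain ⟨N, hN⟩ := ih
    obtain ⟨N', hN'⟩ := exists_starSet_rich_isHomogeneous (M := M) τ k N
    refine ⟨N', fun F hF Y => ?_⟩
    obtain ⟨F₁, hF₁, hF₁F, hYm⟩ := hN' F hF (Y m)
    obtain ⟨F₂, hF₂, hF₂F₁, hY⟩ := hN F₁ hF₁ Y
    refine ⟨F₂, hF₂, hF₂F₁.trans hF₁F, fun i hi => ?_⟩
    obtain hi | rfl := Nat.lt_succ_iff_lt_or_eq.1 hi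
    · exact hY i hi
    · exact hYm.mono hF₂F₁

/-! ## Saturation -/

theorem exists_forall_mem_of_isInternal {X : ℕ → Set (M.Obj τ)} (hX : ∀ n, IsInternal (X n))
    (h : ∀ n, ∃ x, ∀ m < n, x ∈ X m) : ∃ x, ∀ n, x ∈ X n := by
  choose A hA using hX
  obtain rfl : X = fun n => M.elems (A n) := funext fun n => (hA n).symm
  exact M.saturation A h

theorem exists_forall_mem_of_antitone {X : ℕ → Set (M.Obj τ)} (hX : ∀ n, IsInternal (X n))
    (hanti : Antitone X) (h : ∀ n, (X n).Nonempty) : ∃ x, ∀ n, x ∈ X n :=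
  exists_forall_mem_of_isInternal hX fun n =>
    let ⟨x, hx⟩ := h n
    ⟨x, fun _ hm => hanti hm.le hx⟩

theorem pair_inj {x x' : M.Obj σ} {y y' : M.Obj τ} :
    M.pair x y = M.pair x' y' ↔ x = x' ∧ y = y' := by
  have transferred := (M.transfer (.all σ (.all τ (.all σ (.all τ
    (.iff (.eq (.pair v₃ v₂) (.pair v₁ v₀)) (.and (.eq v₃ v₁) (.eq v₂ v₀))))))) Env.nil).1 <| by
    simp only [Formula.Holds, Formula.holds_iff]
    exact fun _ _ _ _ => Prod.mk_inj
  simp only [Formula.Holds, Formula.holds_iff] at transferred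
  exact transferred x y x' y'

theorem exists_forall_pair_notMem_of_antitone {G : ℕ → Set (M.Obj σ)}
    (hG : ∀ n, IsInternal (G n)) (hGanti : Antitone G) {C : ℕ → Set (M.Obj (.prod (.prod σ σ) τ))}
    (hC : ∀ n, IsInternal (C n)) {a : ℕ → M.Obj τ}
    (hCanti : ∀ r, Antitone fun n => M.pair r (a n) ∈ C n)
    (h : ∀ p q, (∀ n, p ∈ G n) → (∀ n, q ∈ G n) → ∃ n, M.pair (M.pair p q) (a n) ∉ C n) :
    ∃ n, ∀ p ∈ G n, ∀ q ∈ G n, M.pair (M.pair p q) (a n) ∉ C n := by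
  let X (n : ℕ) : Set (M.Obj (.prod σ σ)) :=
    {r | ∃ p ∈ G n, ∃ q ∈ G n, r = M.pair p q ∧ M.pair r (a n) ∈ C n}
  have hX (n) : IsInternal (X n) := by
    obtain ⟨A, hA⟩ := hG n
    obtain ⟨B, hB⟩ := hC n
    have h := isInternal_setOf_holds (.ex σ (.and (.mem v₀ v₂) (.ex σ (.and (.mem v₀ v₃)
      (.and (.eq v₂ (.pair v₁ v₀)) (.mem (.pair v₂ v₅) v₄))))))
      (Env.cons A (Env.cons B (Env.cons (a n) Env.nil)))
    simp only [Formula.Holds, Formula.holds_ex] at h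
    simp only [X, ← hA, ← hB]
    exact h
  have hXanti : Antitone X := fun m n hmn r ⟨p, hp, q, hq, hr, hC⟩ =>
    ⟨p, hGanti hmn hp, q, hGanti hmn hq, hr, hCanti r hmn hC⟩
  by_contra! hmem
  obtain ⟨r, hr⟩ := exists_forall_mem_of_antitone hX hXanti fun n =>
    let ⟨p, hp, q, hq, hpq⟩ := hmem n
    ⟨M.pair p q, p, hp, q, hq, rfl, hpq⟩
  obtain ⟨p, -, q, -, rfl, -⟩ := hr 0
  have hpq (n) : p ∈ G n ∧ q ∈ G n ∧ M.pair (M.pair p q) (a n) ∈ C n := by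
    obtain ⟨p', hp, q', hq, heq, hC⟩ := hr n
    obtain ⟨rfl, rfl⟩ := pair_inj.1 heq
    exact ⟨hp, hq, hC⟩
  obtain ⟨n, hn⟩ := h p q (fun n => (hpq n).1) fun n => (hpq n).2.1
  exact hn (hpq n).2.2

/-! ## A spread homogeneous family of internal sets -/

theorem isInternal_internalSubsets (D : M.Obj (.set τ)) : IsInternal (M.internalSubsets D) := by
  have h := isInternal_setOf_holds (.all τ (.imp (.mem v₀ v₁) (.mem v₀ v₂)))
    (Env.cons D Env.nil)
  simp only [Formula.Holds, Formula.holds_imp] at h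
  exact h

theorem isInternal_setOf_isHomogeneous {Y : Set (M.Obj τ)} (hY : IsInternal Y) :
    IsInternal {F : M.Obj (.set τ) | IsHomogeneous (M.elems F) Y} := by
  obtain ⟨B, rfl⟩ := hY
  have h := isInternal_setOf_holds (.all τ (.imp (.mem v₀ v₁) (.all τ (.imp (.mem v₀ v₂)
    (.imp (.mem v₁ v₃) (.mem v₀ v₃)))))) (Env.cons B Env.nil)
  simp only [Formula.Holds, Formula.holds_imp] at h
  exact h

theorem exists_spread_forall_isHomogeneous {ι : Type*} [Nonempty ι] [Countable ι]
    {D : M.Obj (.set τ)} (hD : (M.elems D).Infinite) {Y : ι → Set (M.Obj (.set τ))}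
    (hY : ∀ i, IsInternal (Y i)) :
    ∃ F : M.Obj (.set (.set τ)), M.elems F ⊆ M.internalSubsets D ∧
      (∀ K, F ∈ M.starSet (τ := .set (.set τ)) (spread τ.Std K)) ∧
      ∀ i, IsHomogeneous (M.elems F) (Y i) := by
  obtain ⟨P, hP⟩ := isInternal_internalSubsets D
  obtain ⟨e, he⟩ := exists_surjective_nat ι
  let X (n : ℕ) : Set (M.Obj (.set (.set τ))) := M.internalSubsets P ∩
    (M.starSet (τ := .set (.set τ)) (spread τ.Std n) ∩
      {F | IsHomogeneous (M.elems F) (Y (e n))})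
  have hX (n) : IsInternal (X n) := (isInternal_internalSubsets P).inter
    ((isInternal_elems _).inter (isInternal_setOf_isHomogeneous (hY (e n))))
  obtain ⟨F, hF⟩ := exists_forall_mem_of_isInternal hX fun n => by
    choose B hB using hY
    obtain ⟨N, hN⟩ := exists_starSet_rich_forall_isHomogeneous (M := M) τ (n + 1)
      ((2 * (n + 1) + 2) * (n + 1)) n
    obtain ⟨F, hFrich, hFP, hFY⟩ := hN P
      (mem_starSet_rich_of_elems_eq_internalSubsets _ _ hD hP) (B ∘ e)
    exact ⟨F, fun m hm => ⟨hFP, starSet_mono (τ := .set (.set τ))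
      ((rich_subset_spread n).trans (spread_anti hm.le)) hFrich, hB (e m) ▸ hFY m hm⟩⟩
  refine ⟨F, hP ▸ (hF 0).1, fun K => (hF K).2.1, fun i => ?_⟩
  obtain ⟨n, rfl⟩ := he i
  exact (hF n).2.2

/-! ## Countably determined sets -/

theorem isInternal_univ : IsInternal (Set.univ : Set (M.Obj τ)) :=
  let ⟨A, hA⟩ := isInternal_setOf_holds (.eq v₀ v₀) Env.nil
  ⟨A, hA.trans (Set.eq_univ_of_forall fun _ => rfl)⟩

theorem IsCD.exists_mem_iff {X : Set (M.Obj τ)} (hX : M.IsCD X) :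
    ∃ (A : ℕ → M.Obj (.set τ)) (B : Set (Set ℕ)), ∀ p, p ∈ X ↔ {m | p ∈ M.elems (A m)} ∈ B := by
  obtain ⟨A, B, rfl⟩ := hX
  refine ⟨A, B \ {∅}, fun p => ?_⟩
  simp only [Set.mem_iUnion, Set.mem_inter_iff, Set.mem_iInter, Set.mem_sdiff, Set.mem_compl_iff,
    Set.mem_singleton_iff, exists_prop]
  constructor
  · rintro ⟨b, hb, hin, hout⟩
    obtain rfl : {m | p ∈ M.elems (A m)} = b :=
      Set.ext fun m => ⟨fun h => by_contra fun hm => (hout m hm).2 h, hin m⟩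
    refine ⟨hb, fun hempty => ?_⟩
    obtain ⟨n, hn⟩ := (hout 0 (hempty ▸ Set.notMem_empty 0)).1
    exact Set.eq_empty_iff_forall_notMem.1 hempty n hn
  · rintro ⟨hb, hne⟩
    exact ⟨_, hb, fun _ => id, fun m hm => ⟨Set.nonempty_iff_ne_empty.2 hne, hm⟩⟩

/-- The points that belong to exactly those of the first `n` sets `A m` for which `m ∈ s`. A
countably determined set is a union of sets `⋂ n, cylinder A s n`. -/
def cylinder (A : ℕ → M.Obj (.set τ)) (s : Set ℕ) (n : ℕ) : Set (M.Obj τ) :=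
  {p | ∀ m < n, p ∈ M.elems (A m) ↔ m ∈ s}

section Cylinder

variable {A : ℕ → M.Obj (.set τ)} {s : Set ℕ}

theorem cylinder_anti : Antitone (cylinder A s) :=
  fun _ _ h _ hp m hm => hp m (hm.trans_le h)

theorem forall_mem_cylinder_iff {p : M.Obj τ} :
    (∀ n, p ∈ cylinder A s n) ↔ {m | p ∈ M.elems (A m)} = s :=
  ⟨fun h => Set.ext fun m => h (m + 1) m m.lt_succ_self, fun h _ m _ => Set.ext_iff.1 h m⟩

theorem isInternal_cylinder (n : ℕ) : IsInternal (cylinder A s n) := by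
  induction n with
  | zero =>
    rw [show cylinder A s 0 = Set.univ from
      Set.eq_univ_of_forall fun _ m hm => absurd hm m.not_lt_zero]
    exact isInternal_univ
  | succ n ih =>
    have hn : IsInternal {p | p ∈ M.elems (A n) ↔ n ∈ s} := by
      by_cases h : n ∈ s
      · simp only [h, iff_true]
        exact isInternal_elems (A n)
      · simp only [h, iff_false]
        exact (isInternal_elems (A n)).compl
    convert ih.inter hn using 1
    ext p
    exact Nat.forall_lt_succ_right

theorem cylinder_inter_Iio (n : ℕ) : cylinder A (s ∩ Set.Iio n) n = cylinder A s n :=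
  Set.ext fun _ => forall₂_congr fun m hm => by simp [hm]

end Cylinder

theorem exists_forall_pair_mem_cylinder {A : ℕ → M.Obj (.set (.prod σ τ))} {F : Set (M.Obj σ)}
    (hF : ∀ (s : Finset ℕ) (n : ℕ), IsHomogeneous F {u | ∃ y, M.pair u y ∈ cylinder A s n})
    {u v : M.Obj σ} (hu : u ∈ F) (hv : v ∈ F) {s : Set ℕ} {y : M.Obj τ}
    (hy : ∀ n, M.pair u y ∈ cylinder A s n) : ∃ z, ∀ n, M.pair v z ∈ cylinder A s n := by
  refine exists_forall_mem_of_antitone (fun n => (isInternal_cylinder n).preimage_pair v)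
    (fun _ _ h _ hz => cylinder_anti h hz) fun n => ?_
  have hfin : (s ∩ Set.Iio n).Finite := (Set.finite_Iio n).inter_of_right s
  have hhom := hF hfin.toFinset n u hu v hv
  rw [hfin.coe_toFinset, cylinder_inter_Iio] at hhom
  exact hhom ⟨y, hy n⟩

theorem isInternal_exists_pair_mem {X : Set (M.Obj (.prod σ τ))} (hX : IsInternal X) :
    IsInternal {u | ∃ y, M.pair u y ∈ X} := by
  obtain ⟨A, rfl⟩ := hX
  have h := isInternal_setOf_holds (.ex τ (.mem (.pair v₁ v₀) v₂)) (Env.cons A Env.nil)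
  simp only [Formula.Holds, Formula.holds_ex] at h
  exact h

theorem exists_spread_antitone_of_isCD {D : M.Obj (.set τ)} (hD : (M.elems D).Infinite)
    {θ : M.internalSubsets D → M.Obj σ}
    (hθ : M.IsCD {p | ∃ x : M.internalSubsets D, p = M.pair (x : M.Obj (.set τ)) (θ x)}) :
    ∃ (F : M.Obj (.set (.set τ))) (G : ℕ → Set (M.Obj (.prod (.set τ) σ))),
      (∀ K, F ∈ M.starSet (τ := .set (.set τ)) (spread τ.Std K)) ∧
      (∀ n, IsInternal (G n)) ∧ Antitone G ∧
      (∀ u ∈ M.elems F, ∃ y, ∀ n, M.pair u y ∈ G n) ∧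
      ∀ p, (∀ n, p ∈ G n) → ∃ x : M.internalSubsets D, p = M.pair (x : M.Obj (.set τ)) (θ x) := by
  obtain ⟨A, B, hAB⟩ := hθ.exists_mem_iff
  obtain ⟨F, hFD, hF, hhom⟩ := exists_spread_forall_isHomogeneous (ι := Finset ℕ × ℕ) hD
    fun i => isInternal_exists_pair_mem (isInternal_cylinder (A := A) (s := i.1) i.2)
  obtain ⟨u₀, hu₀⟩ := nonempty_of_mem_starSet_spread (hF 0)
  let p₀ := M.pair u₀ (θ ⟨u₀, hFD hu₀⟩)
  let s := {m | p₀ ∈ M.elems (A m)}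
  have hs : s ∈ B := (hAB p₀).1 ⟨⟨u₀, hFD hu₀⟩, rfl⟩
  refine ⟨F, cylinder A s, hF, isInternal_cylinder, cylinder_anti, fun u hu => ?_,
    fun p hp => (hAB p).2 ?_⟩
  · exact exists_forall_pair_mem_cylinder (fun s n => hhom (s, n)) hu₀ hu
      (forall_mem_cylinder_iff.2 rfl)
  · rwa [forall_mem_cylinder_iff.1 hp]

/-! ## Reductions -/

theorem monadic_iUnion_iff {a : ℕ → M.HyperNat} {y z : M.HyperNat} :
    M.monadic (⋃ n, {x | M.Lt x (a n)}) y z ↔ ∃ n, M.DistLt y z (a n) := by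
  simp only [monadic, DistLt, Set.mem_iUnion, Set.mem_ofPred_eq]
  exact ⟨fun ⟨d, ⟨n, hlt⟩, hd⟩ => ⟨n, d, hlt, hd⟩, fun ⟨n, d, hlt, hd⟩ => ⟨d, ⟨n, hlt⟩, hd⟩⟩

section Reduction

variable {X : Set (M.Obj (.set τ))} {θ : X → M.HyperNat}
  {G : ℕ → Set (M.Obj (.prod (.set τ) .nat))}

theorem exists_forall_pair_notMem_torn (hG : ∀ n, IsInternal (G n)) (hGanti : Antitone G)
    (hGθ : ∀ p, (∀ n, p ∈ G n) → ∃ x : X, p = M.pair (x : M.Obj (.set τ)) (θ x))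
    {a : ℕ → M.HyperNat} (ha : ∀ m n, m < n → M.Lt (a m) (a n))
    (hθ : ∀ x x' : X, (symmDiff (M.elems (x : M.Obj (.set τ))) (M.elems x')).Finite →
      ∃ n, M.DistLt (θ x) (θ x') (a n)) :
    ∃ n, ∀ p ∈ G n, ∀ q ∈ G n,
      M.pair (M.pair p q) (a n) ∉ M.starSet (τ := τ.comparison) (torn τ.Std) := by
  refine exists_forall_pair_notMem_of_antitone hG hGanti (fun _ => isInternal_elems _)
    (fun r m n hmn hr => ?_) fun p q hp hq => ?_
  · obtain rfl | hmn := hmn.eq_or_lt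
    · exact hr
    · exact pair_mem_starSet_torn_of_lt (ha m n hmn) hr
  · obtain ⟨x, rfl⟩ := hGθ p hp
    obtain ⟨x', rfl⟩ := hGθ q hq
    by_contra! htorn
    obtain ⟨n, hn⟩ := hθ x x' <|
      exists_mem_closeLE_iff_finite.1 ⟨2, (mem_starSet_torn.1 (htorn 0)).1⟩
    exact (mem_starSet_torn.1 (htorn n)).2 hn

theorem exists_forall_pair_notMem_glued (hG : ∀ n, IsInternal (G n)) (hGanti : Antitone G)
    (hGθ : ∀ p, (∀ n, p ∈ G n) → ∃ x : X, p = M.pair (x : M.Obj (.set τ)) (θ x))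
    {a : M.HyperNat}
    (hθ : ∀ x x' : X, M.DistLt (θ x) (θ x') a →
      (symmDiff (M.elems (x : M.Obj (.set τ))) (M.elems x')).Finite) :
    ∃ K, ∀ p ∈ G K, ∀ q ∈ G K,
      M.pair (M.pair p q) a ∉ M.starSet (τ := τ.comparison) (glued τ.Std K) := by
  refine exists_forall_pair_notMem_of_antitone hG hGanti (fun _ => isInternal_elems _)
    (fun r K L hKL hr => ?_) fun p q hp hq => ?_
  · exact starSet_mono (τ := τ.comparison) (glued_anti hKL) hr
  · obtain ⟨x, rfl⟩ := hGθ p hp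
    obtain ⟨x', rfl⟩ := hGθ q hq
    by_contra! hglued
    obtain ⟨K, hK⟩ := exists_mem_closeLE_iff_finite.2 <|
      hθ x x' (mem_starSet_glued.1 (hglued 0)).2
    exact (mem_starSet_glued.1 (hglued K)).1 hK

end Reduction

end Universe

end Nonstandard

open Nonstandard Nonstandard.Universe in
theorem mainTheorem9_general (M : Universe.{u}) {τ : Ty} (D : M.Obj (.set τ))
    (hD : (M.elems D).Infinite) (U : Set M.HyperNat) (hU : M.IsCountablyCofinal U) :
    ¬ M.CDReducible (M.internalSubsets D) (fun v w => (symmDiff (M.elems v) (M.elems w)).Finite)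
      Set.univ (M.monadic U) := by
  rintro ⟨θ, hθ, hred⟩
  obtain ⟨a, ha, rfl⟩ := hU
  simp only [monadic_iUnion_iff] at hred
  obtain ⟨F, G, hF, hG, hGanti, htotal, hGθ⟩ := exists_spread_antitone_of_isCD hD hθ
  obtain ⟨n, hn⟩ := exists_forall_pair_notMem_torn hG hGanti hGθ ha fun x x' => (hred x x').1
  obtain ⟨K, hK⟩ := exists_forall_pair_notMem_glued hG hGanti hGθ (a := a n)
    fun x x' h => (hred x x').2 ⟨n, h⟩
  let L := max n K
  obtain ⟨p, hp, q, hq, hpq⟩ := exists_mem_glued_of_mem_starSet_spread (hF L) (hG L) (a n)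
    (fun u hu => (htotal u hu).imp fun _ h => h L)
    fun p hp q hq => hn p (hGanti (le_max_left n K) hp) q (hGanti (le_max_left n K) hq)
  exact hK p (hGanti (le_max_right n K) hp) q (hGanti (le_max_right n K) hq)
    (starSet_mono (τ := τ.comparison) (glued_anti (le_max_right n K)) hpq)

/-- For an infinite hyperfinite set `D` of hypernatural numbers and an additive countably cofinal
cut `U`, the finite difference relation restricted to the internal subsets of `D` is not
CD-reducible to the monadic relation of `U` on the hypernatural numbers. -/
theorem mainTheorem9 (M : Nonstandard.Universe.{u})
    (D : M.Obj (.set .nat)) (hD : M.Hyperfinite D) (hDinf : (M.elems D).Infinite)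
    (U : Set M.HyperNat) (hcut : M.IsCut U) (hadd : M.IsAdditive U)
    (hcof : M.IsCountablyCofinal U) :
    ¬ M.CDReducible (M.internalSubsets D) M.FD Set.univ (M.monadic U) :=
  mainTheorem9_general M D hDinf U hcof
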